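/- Let $T$ be a bounded linear operator on a complex Hilbert space $X$ which is power-bounded, that is, $\sup_{n\ge 0}\|T^n\|<\infty$, and suppose that its spectrum satisfies $\sigma(T)\cap\mathbb{T}\subseteq\{1\}$, where $\mathbb{T}=\{z\in\mathbb{C}:|z|=1\}$. Let $\alpha\ge 1$ and suppose that $\|(e^{i\theta}I-T)^{-1}\| = O(|\theta|^{-\alpha})$ as $\theta\to 0$ (where $\theta\in\mathbb{R}$, $\theta\neq 0$). Then $\|T^n(I-T)\| = O(n^{-1/\alpha})$ as $n\to\infty$. -/

import Mathlib

open Filter Topology Asymptotics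

/-- A bounded operator is power-bounded if the norms of its powers are uniformly bounded. -/
def IsPowerBoundedOperator {X : Type*} [NormedAddCommGroup X] [NormedSpace ℂ X]
    (T : X →L[ℂ] X) : Prop :=
  ∃ M : ℝ, ∀ n : ℕ, ‖T ^ n‖ ≤ M

/-- The unitary spectrum: the part of the spectrum lying on the unit circle. -/
def unitarySpectrum {X : Type*} [NormedAddCommGroup X] [NormedSpace ℂ X]
    (T : X →L[ℂ] X) : Set ℂ :=
  spectrum ℂ T ∩ Metric.sphere (0 : ℂ) 1

/-!
The proof works with finite sums only: no contour integrals, no fractional powers of `1 - T` and no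
resolvent values off the unit circle.

* *Hilbert space step* (`norm_pow_mul_le_of_resolvent_mul_bound`). Let `S` commute with `T` and let
  `‖R(z, T) S‖ ≤ K` for all unimodular `z ≠ 1`. For a sequence `c` with `c 0 = c L = 0`, summation
  by parts gives `(z - T) ∑ c k z⁻ᵏ Tᵏ = ∑ (c (k + 1) - c k) z⁻ᵏ Tᵏ⁺¹`. With `c` the tent function of
  height `n` on `[0, 2n]` the differences are `±1`, and Parseval's identity over the `2n`-th roots of
  `-1` (which avoid the singular point `1`) yields `∑ k² ‖Tᵏ S x‖² ≤ 2n K² M² ‖x‖²`, where the sum is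
  over `k ≤ n`. As `‖Tⁿ S x‖ ≤ M ‖Tᵏ S x‖` for such `k`, the left side dominates a multiple of
  `n³ ‖Tⁿ S x‖²`, so `‖Tⁿ S‖ = O(K / n)`.
* *Regularisation*. Let `A` be the Cesàro mean of `1, T, …, Tᵐ⁻¹`. Then `(1 - T) A = (1 - Tᵐ) / m`
  has norm `O(1 / m)`, hence so has `(1 - T) - S` for `S = (1 - T) (1 - A) ^ p`. On the other hand
  `1 - A = (1 - T) B` with `‖B‖ ≤ M m`, and this gives `‖R(z, T) S‖ = O(m ^ (α - 1))` uniformly in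
  `z` once `p ≥ α` (`exists_resolvent_mul_cesaro_bound`): where `‖1 - z‖ ≥ 1 / m` the resolvent
  bound is small enough by itself, elsewhere the zero of order `p` supplied by `1 - A` offsets it.

Together `‖Tⁿ (1 - T)‖ = O(m ^ (α - 1) / n + 1 / m)`, and `m ≈ n ^ (1 / α)` balances the two terms.
-/

/-! ### Parseval's identity on a rotated group of roots of unity -/

/-- Orthogonality of the characters `k ↦ (ζ ω ^ j) ^ k`. -/
lemma sum_conj_pow_mul_pow_eq {L : ℕ} {ζ ω : ℂ} (hζ : ‖ζ‖ = 1) (hω : IsPrimitiveRoot ω L)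
    (hω1 : ‖ω‖ = 1) {k l : ℕ} (hk : k < L) (hl : l < L) :
    ∑ j ∈ Finset.range L, (starRingEnd ℂ) ((ζ * ω ^ j) ^ k) * (ζ * ω ^ j) ^ l
      = if k = l then (L : ℂ) else 0 := by
  have hunit : ∀ u : ℂ, ‖u‖ = 1 → (starRingEnd ℂ) u * u = 1 := fun u hu => by
    rw [Complex.conj_mul', hu]; norm_num
  split_ifs with h
  · subst h
    have : ∀ j ∈ Finset.range L,
        (starRingEnd ℂ) ((ζ * ω ^ j) ^ k) * (ζ * ω ^ j) ^ k = 1 := fun j _ =>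
      hunit _ (by simp [hζ, hω1])
    rw [Finset.sum_congr rfl this]
    simp
  · set q : ℂ := (starRingEnd ℂ) ω ^ k * ω ^ l with hq
    have hterm : ∀ j ∈ Finset.range L,
        (starRingEnd ℂ) ((ζ * ω ^ j) ^ k) * (ζ * ω ^ j) ^ l
          = ((starRingEnd ℂ) ζ ^ k * ζ ^ l) * q ^ j := by
      intro j _
      simp only [map_pow, map_mul, hq]
      ring
    rw [Finset.sum_congr rfl hterm, ← Finset.mul_sum]
    have hq1 : q ≠ 1 := by
      intro hq1
      apply h
      apply hω.pow_inj hk hl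
      calc ω ^ k = ω ^ k * q := by rw [hq1, mul_one]
        _ = ((starRingEnd ℂ) ω * ω) ^ k * ω ^ l := by rw [hq]; ring
        _ = ω ^ l := by rw [hunit ω hω1]; simp
    have hqL : q ^ L = 1 := by
      have : q ^ L = ((starRingEnd ℂ) (ω ^ L)) ^ k * (ω ^ L) ^ l := by
        rw [hq, map_pow]; ring
      rw [this, hω.pow_eq_one]; simp
    have := geom_sum_mul q L
    rw [hqL, sub_self] at this
    rw [(mul_eq_zero.1 this).resolve_right (sub_ne_zero.2 hq1), mul_zero]

lemma sum_norm_sq_sum_pow_smul {X : Type*} [NormedAddCommGroup X] [InnerProductSpace ℂ X]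
    {L : ℕ} {ζ ω : ℂ} (hζ : ‖ζ‖ = 1) (hω : IsPrimitiveRoot ω L) (hω1 : ‖ω‖ = 1) (v : ℕ → X) :
    ∑ j ∈ Finset.range L, ‖∑ k ∈ Finset.range L, (ζ * ω ^ j) ^ k • v k‖ ^ 2
      = L * ∑ k ∈ Finset.range L, ‖v k‖ ^ 2 := by
  have key : ∑ j ∈ Finset.range L,
      inner ℂ (∑ k ∈ Finset.range L, (ζ * ω ^ j) ^ k • v k)
        (∑ k ∈ Finset.range L, (ζ * ω ^ j) ^ k • v k)
      = (L : ℂ) * ∑ k ∈ Finset.range L, inner ℂ (v k) (v k) := by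
    simp only [sum_inner, inner_sum, inner_smul_left, inner_smul_right, Finset.mul_sum]
    rw [Finset.sum_comm]
    refine Finset.sum_congr rfl fun k hk => ?_
    rw [Finset.sum_comm]
    have : ∀ l ∈ Finset.range L, ∑ j ∈ Finset.range L,
        (ζ * ω ^ j) ^ k * ((starRingEnd ℂ) ((ζ * ω ^ j) ^ l) * inner ℂ (v l) (v k))
          = if l = k then (L : ℂ) * inner ℂ (v l) (v k) else 0 := by
      intro l hl
      have h := sum_conj_pow_mul_pow_eq hζ hω hω1 (Finset.mem_range.1 hl) (Finset.mem_range.1 hk)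
      calc _ = (∑ j ∈ Finset.range L,
            (starRingEnd ℂ) ((ζ * ω ^ j) ^ l) * (ζ * ω ^ j) ^ k) * inner ℂ (v l) (v k) := by
            rw [Finset.sum_mul]
            exact Finset.sum_congr rfl fun j _ => by ring
        _ = _ := by rw [h]; split_ifs <;> simp
    rw [Finset.sum_congr rfl this, Finset.sum_ite_eq', if_pos hk]
  simp only [inner_self_eq_norm_sq_to_K] at key
  apply Complex.ofReal_injective
  push_cast
  exact key

/-- A rotation of the `L`-th roots of unity that avoids `1`: the `L`-th roots of `-1`. -/
lemma exists_rotated_primitiveRoot {L : ℕ} (hL : L ≠ 0) :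
    ∃ ζ ω : ℂ, ‖ζ‖ = 1 ∧ IsPrimitiveRoot ω L ∧ ‖ω‖ = 1 ∧ ∀ j : ℕ, ζ * ω ^ j ≠ 1 := by
  have hω := Complex.isPrimitiveRoot_exp L hL
  have hL' : (L : ℂ) ≠ 0 := by exact_mod_cast hL
  refine ⟨Complex.exp ((Real.pi / L : ℝ) * Complex.I), _, Complex.norm_exp_ofReal_mul_I _, hω,
    hω.norm'_eq_one hL, fun j h => ?_⟩
  have hζ : Complex.exp ((Real.pi / L : ℝ) * Complex.I) ^ L = -1 := by
    rw [← Complex.exp_nat_mul, ← Complex.exp_pi_mul_I]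
    congr 1
    push_cast
    field_simp
  have h2 := congrArg (· ^ L) h
  simp only [mul_pow, one_pow, hζ, ← pow_mul, mul_comm j L] at h2
  rw [pow_mul, hω.pow_eq_one] at h2
  norm_num at h2

/-! ### Decay of `Tⁿ S` from a resolvent bound -/

/-- Summation by parts for the resolvent equation. -/
lemma sub_mul_sum_pow {X : Type*} [NormedAddCommGroup X] [NormedSpace ℂ X]
    (T : X →L[ℂ] X) {z : ℂ} (hz : z ≠ 0) {L : ℕ} {c : ℕ → ℂ} (h0 : c 0 = 0) (hL : c L = 0) :
    (algebraMap ℂ (X →L[ℂ] X) z⁻¹ - T) * ∑ k ∈ Finset.range L, z ^ k • (c k • T ^ k)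
      = ∑ k ∈ Finset.range L, z ^ k • ((c (k + 1) - c k) • T ^ (k + 1)) := by
  have hshift : ∑ k ∈ Finset.range L, z ^ k • (c k • T ^ k)
      = ∑ k ∈ Finset.range L, z ^ (k + 1) • (c (k + 1) • T ^ (k + 1)) := by
    have h1 := Finset.sum_range_succ (fun k => z ^ k • (c k • T ^ k)) L
    have h2 := Finset.sum_range_succ' (fun k => z ^ k • (c k • T ^ k)) L
    simp only [h0, hL, zero_smul, smul_zero, add_zero] at h1 h2
    exact h1.symm.trans h2
  rw [sub_mul, ← Algebra.smul_def]
  conv_lhs => arg 1; rw [hshift]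
  rw [Finset.smul_sum, Finset.mul_sum, ← Finset.sum_sub_distrib]
  refine Finset.sum_congr rfl fun k _ => ?_
  rw [mul_smul_comm, mul_smul_comm, ← pow_succ', smul_smul, sub_smul, smul_sub, pow_succ z,
    mul_comm (z ^ k) z, inv_mul_cancel_left₀ hz]

/-- On a Hilbert space, a bound `K` for `R(z, T) S` along the punctured unit circle forces `Tⁿ S` to
decay like `K / n`. -/
lemma norm_pow_mul_le_of_resolvent_mul_bound {X : Type*} [NormedAddCommGroup X]
    [InnerProductSpace ℂ X] {T S : X →L[ℂ] X} (hTS : Commute T S) {M K : ℝ}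
    (hM : ∀ n : ℕ, ‖T ^ n‖ ≤ M) (hK : 0 ≤ K)
    (hu : ∀ z : ℂ, ‖z‖ = 1 → z ≠ 1 → z ∈ resolventSet ℂ T)
    (hS : ∀ z : ℂ, ‖z‖ = 1 → z ≠ 1 → ‖resolvent T z * S‖ ≤ K) {n : ℕ} (hn : 0 < n) :
    ‖T ^ n * S‖ ≤ 3 * M ^ 2 * K / n := by
  have hM0 : 0 ≤ M := (norm_nonneg _).trans (hM 0)
  have hn' : (0 : ℝ) < n := by exact_mod_cast hn
  refine ContinuousLinearMap.opNorm_le_bound _ (by positivity) fun x => ?_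
  obtain ⟨ζ, ω, hζ, hω, hω1, hne⟩ := exists_rotated_primitiveRoot (L := 2 * n) (by omega)
  -- the tent function
  set c : ℕ → ℝ := fun k => n - |(k : ℝ) - n| with hc
  have hc0 : c 0 = 0 := by simp [hc]
  have hcL : c (2 * n) = 0 := by
    simp only [hc]; push_cast
    rw [show (2 * n - n : ℝ) = n by ring, abs_of_pos hn', sub_self]
  have hcd : ∀ k, |c (k + 1) - c k| ≤ 1 := fun k => by
    simp only [hc]
    have := abs_abs_sub_abs_le_abs_sub ((k : ℝ) - n) ((k + 1 : ℕ) - n : ℝ)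
    rw [show ((k : ℝ) - n) - ((k + 1 : ℕ) - n : ℝ) = -1 by push_cast; ring] at this
    rw [show (n - |((k + 1 : ℕ) : ℝ) - n|) - (n - |(k : ℝ) - n|)
      = |(k : ℝ) - n| - |((k + 1 : ℕ) : ℝ) - n| by ring]
    simpa using this
  have hck : ∀ k ≤ n, c k = k := fun k hk => by
    have : (k : ℝ) ≤ n := by exact_mod_cast hk
    simp only [hc]
    rw [abs_of_nonpos (by linarith)]; ring
  have hpt : ∀ j : ℕ,
      ‖∑ k ∈ Finset.range (2 * n), (ζ * ω ^ j) ^ k • ((c k : ℂ) • (T ^ k * S) x)‖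
        ≤ K * ‖∑ k ∈ Finset.range (2 * n),
          (ζ * ω ^ j) ^ k • (((c (k + 1) : ℂ) - c k) • (T ^ (k + 1)) x)‖ := by
    intro j
    set z := ζ * ω ^ j with hz
    have hz1 : ‖z‖ = 1 := by simp [hz, hζ, hω1]
    have hz0 : z ≠ 0 := by rintro h; simp [h] at hz1
    have hzi : ‖z⁻¹‖ = 1 := by simp [hz1]
    have hzi1 : z⁻¹ ≠ 1 := by
      rw [Ne, inv_eq_one]; exact hne j
    have hparts := sub_mul_sum_pow T hz0 (L := 2 * n) (c := fun k => (c k : ℂ))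
      (by simp [hc0]) (by simp [hcL])
    have hinv : resolvent T z⁻¹ * (algebraMap ℂ (X →L[ℂ] X) z⁻¹ - T) = 1 :=
      Ring.inverse_mul_cancel _ (hu _ hzi hzi1)
    set P := ∑ k ∈ Finset.range (2 * n), z ^ k • ((c k : ℂ) • T ^ k) with hP
    set D := ∑ k ∈ Finset.range (2 * n),
      z ^ k • (((c (k + 1) : ℂ) - c k) • T ^ (k + 1)) with hD
    have hPR : P = resolvent T z⁻¹ * D := by
      rw [← hparts, ← mul_assoc, hinv, one_mul]
    have hDS : Commute D S := by
      refine Commute.sum_left _ _ _ fun k _ => ?_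
      exact ((hTS.pow_left _).smul_left _).smul_left _
    have hPS : P * S = (resolvent T z⁻¹ * S) * D := by
      rw [hPR, mul_assoc, hDS.eq, ← mul_assoc]
    have e1 : ∑ k ∈ Finset.range (2 * n), z ^ k • ((c k : ℂ) • (T ^ k * S) x) = (P * S) x := by
      simp [hP]
    have e2 : ∑ k ∈ Finset.range (2 * n),
        z ^ k • (((c (k + 1) : ℂ) - c k) • (T ^ (k + 1)) x) = D x := by
      simp [hD]
    rw [e1, e2, hPS]
    exact ContinuousLinearMap.le_of_opNorm_le _ (hS _ hzi hzi1) (D x)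
  have hsum : ∑ k ∈ Finset.range (2 * n), ‖(c k : ℂ) • (T ^ k * S) x‖ ^ 2
      ≤ K ^ 2 * ∑ k ∈ Finset.range (2 * n), ‖((c (k + 1) : ℂ) - c k) • (T ^ (k + 1)) x‖ ^ 2 := by
    have h1 := sum_norm_sq_sum_pow_smul hζ hω hω1 (fun k => (c k : ℂ) • (T ^ k * S) x)
    have h2 := sum_norm_sq_sum_pow_smul hζ hω hω1
      (fun k => ((c (k + 1) : ℂ) - c k) • (T ^ (k + 1)) x)
    have hL : (0 : ℝ) < ((2 * n : ℕ) : ℝ) := by exact_mod_cast (by omega : 0 < 2 * n)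
    refine le_of_mul_le_mul_left ?_ hL
    rw [← h1, mul_left_comm, ← h2, Finset.mul_sum]
    refine Finset.sum_le_sum fun j _ => ?_
    rw [← mul_pow]
    exact pow_le_pow_left₀ (norm_nonneg _) (hpt j) 2
  have hup : ∑ k ∈ Finset.range (2 * n), ‖((c (k + 1) : ℂ) - c k) • (T ^ (k + 1)) x‖ ^ 2
      ≤ 2 * n * (M * ‖x‖) ^ 2 := by
    have : ∀ k ∈ Finset.range (2 * n),
        ‖((c (k + 1) : ℂ) - c k) • (T ^ (k + 1)) x‖ ^ 2 ≤ (M * ‖x‖) ^ 2 := by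
      intro k _
      refine pow_le_pow_left₀ (norm_nonneg _) ?_ 2
      rw [norm_smul, ← Complex.ofReal_sub, Complex.norm_real, Real.norm_eq_abs]
      calc _ ≤ 1 * (M * ‖x‖) := mul_le_mul (hcd k)
            (ContinuousLinearMap.le_of_opNorm_le _ (hM _) x) (norm_nonneg _) zero_le_one
        _ = _ := one_mul _
    refine (Finset.sum_le_sum this).trans (le_of_eq ?_)
    simp
  have hcube : ∀ N : ℕ, (N : ℝ) ^ 3 / 3 ≤ ∑ k ∈ Finset.range (N + 1), (k : ℝ) ^ 2 := by
    intro N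
    induction N with
    | zero => simp
    | succ N ih =>
      rw [Finset.sum_range_succ]
      push_cast
      have : (0 : ℝ) ≤ N := N.cast_nonneg
      nlinarith
  have hlow : (n : ℝ) ^ 3 / 3 * ‖(T ^ n * S) x‖ ^ 2
      ≤ M ^ 2 * ∑ k ∈ Finset.range (2 * n), ‖(c k : ℂ) • (T ^ k * S) x‖ ^ 2 := by
    have hterm : ∀ k ∈ Finset.range (n + 1), (k : ℝ) ^ 2 * ‖(T ^ n * S) x‖ ^ 2
        ≤ M ^ 2 * ‖(c k : ℂ) • (T ^ k * S) x‖ ^ 2 := by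
      intro k hk
      have hkn : k ≤ n := Nat.lt_succ_iff.1 (Finset.mem_range.1 hk)
      have hfac : (T ^ n * S) x = (T ^ (n - k)) ((T ^ k * S) x) := by
        rw [← mul_apply_eq_comp, ← mul_assoc, ← pow_add, Nat.sub_add_cancel hkn]
      have hle : ‖(T ^ n * S) x‖ ≤ M * ‖(T ^ k * S) x‖ := by
        rw [hfac]; exact ContinuousLinearMap.le_of_opNorm_le _ (hM _) _
      rw [norm_smul, hck k hkn, Complex.norm_real, Real.norm_eq_abs, mul_pow, sq_abs,
        mul_left_comm, ← mul_pow M]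
      exact mul_le_mul_of_nonneg_left (pow_le_pow_left₀ (norm_nonneg _) hle 2) (sq_nonneg _)
    calc (n : ℝ) ^ 3 / 3 * ‖(T ^ n * S) x‖ ^ 2
        ≤ (∑ k ∈ Finset.range (n + 1), (k : ℝ) ^ 2) * ‖(T ^ n * S) x‖ ^ 2 :=
          mul_le_mul_of_nonneg_right (hcube n) (sq_nonneg _)
      _ ≤ M ^ 2 * ∑ k ∈ Finset.range (n + 1), ‖(c k : ℂ) • (T ^ k * S) x‖ ^ 2 := by
          rw [Finset.sum_mul, Finset.mul_sum]; exact Finset.sum_le_sum hterm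
      _ ≤ _ := by
          refine mul_le_mul_of_nonneg_left ?_ (sq_nonneg _)
          exact Finset.sum_le_sum_of_subset_of_nonneg
            (Finset.range_subset_range.2 (by omega)) fun _ _ _ => sq_nonneg _
  have hfin : (n * ‖(T ^ n * S) x‖) ^ 2 ≤ (3 * M ^ 2 * K * ‖x‖) ^ 2 := by
    have h1 : (n : ℝ) ^ 3 / 3 * ‖(T ^ n * S) x‖ ^ 2
        ≤ M ^ 2 * (K ^ 2 * (2 * n * (M * ‖x‖) ^ 2)) :=
      hlow.trans (mul_le_mul_of_nonneg_left
        (hsum.trans (mul_le_mul_of_nonneg_left hup (sq_nonneg _))) (sq_nonneg _))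
    have h2 : (n : ℝ) * (n * ‖(T ^ n * S) x‖) ^ 2 ≤ n * (6 * (M ^ 2 * K * ‖x‖) ^ 2) := by
      nlinarith
    have h3 := le_of_mul_le_mul_left h2 hn'
    nlinarith [sq_nonneg (M ^ 2 * K * ‖x‖)]
  have := (le_abs_self _).trans (abs_le_of_sq_le_sq hfin (by positivity))
  rw [div_mul_eq_mul_div, le_div_iff₀ hn', mul_comm]
  exact this

/-! ### The resolvent on the punctured unit circle -/

lemma mem_resolventSet_of_unitarySpectrum_subset {X : Type*} [NormedAddCommGroup X]
    [NormedSpace ℂ X] {T : X →L[ℂ] X} (hσ : unitarySpectrum T ⊆ {1}) {z : ℂ} (hz : ‖z‖ = 1)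
    (hz1 : z ≠ 1) : z ∈ resolventSet ℂ T := by
  by_contra h
  exact hz1 (hσ ⟨h, by simpa using hz⟩)

/-- The local growth bound at `1` extends to the whole punctured circle by compactness, with the
angle `|θ|` replaced by the chord `‖1 - z‖`. -/
lemma exists_resolvent_bound_circle {X : Type*} [NormedAddCommGroup X] [NormedSpace ℂ X]
    [CompleteSpace X] {T : X →L[ℂ] X} (hσ : unitarySpectrum T ⊆ {1}) {α : ℝ} (hα : 0 ≤ α)
    (hres : (fun θ : ℝ => ‖resolvent T (Complex.exp (Complex.I * (θ : ℂ)))‖)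
      =O[𝓝[≠] (0 : ℝ)] fun θ : ℝ => |θ| ^ (-α)) :
    ∃ C : ℝ, 0 ≤ C ∧ ∀ z : ℂ, ‖z‖ = 1 → z ≠ 1 →
      ‖resolvent T z‖ ≤ C * ‖1 - z‖ ^ (-α) := by
  obtain ⟨C₁, hC₁, hb⟩ := hres.exists_pos
  rw [IsBigOWith, eventually_nhdsWithin_iff, Metric.eventually_nhds_iff] at hb
  obtain ⟨δ, hδ, hb⟩ := hb
  have hcpt : IsCompact (Metric.sphere (0 : ℂ) 1 ∩ {z | δ ≤ |z.arg|}) := by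
    have heq : Metric.sphere (0 : ℂ) 1 ∩ {z | δ ≤ |z.arg|}
        = (fun θ : ℝ => Complex.exp (Complex.I * (θ : ℂ))) ''
          (Set.Icc (-Real.pi) Real.pi ∩ {θ | δ ≤ |θ|}) := by
      ext z
      constructor
      · rintro ⟨hz, hd⟩
        refine ⟨z.arg, ⟨⟨(Complex.neg_pi_lt_arg z).le, Complex.arg_le_pi z⟩, hd⟩, ?_⟩
        have := Complex.norm_mul_exp_arg_mul_I z
        rw [mem_sphere_zero_iff_norm.1 hz] at this
        simpa [mul_comm] using this
      · rintro ⟨θ, ⟨⟨h1, h2⟩, hd⟩, rfl⟩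
        have hd : δ ≤ |θ| := hd
        refine ⟨by simp [mul_comm Complex.I], ?_⟩
        rcases h1.eq_or_lt with h1 | h1
        · have : Complex.exp (Complex.I * (θ : ℂ)) = -1 := by
            rw [← h1, mul_comm]; push_cast
            rw [neg_mul, Complex.exp_neg, Complex.exp_pi_mul_I]; norm_num
          simp only [Set.mem_ofPred_eq, this, Complex.arg_neg_one]
          rwa [← h1, abs_neg] at hd
        · simp only [Set.mem_ofPred_eq]
          rwa [mul_comm, Complex.arg_exp_mul_I, toIocMod_eq_self Real.two_pi_pos |>.2]
          exact ⟨h1, by linarith⟩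
    rw [heq]
    refine IsCompact.image ?_ (by fun_prop)
    exact isCompact_Icc.inter_right (isClosed_le continuous_const continuous_abs)
  have hcont : ContinuousOn (fun z => resolvent T z)
      (Metric.sphere (0 : ℂ) 1 ∩ {z | δ ≤ |z.arg|}) := by
    rintro z ⟨hz, hd⟩
    have hz1 : z ≠ 1 := by
      rintro rfl
      have hd : δ ≤ |Complex.arg 1| := hd
      simp at hd; linarith
    exact (spectrum.hasDerivAt_resolvent_const_left (mem_resolventSet_of_unitarySpectrum_subset hσ
      (by simpa using hz) hz1)).continuousAt.continuousWithinAt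
  obtain ⟨C₂, hC₂⟩ := hcpt.exists_bound_of_continuousOn hcont
  have h2α : 0 < (2 : ℝ) ^ (-α) := by positivity
  refine ⟨C₁ + |C₂| / 2 ^ (-α), by positivity, fun z hz hz1 => ?_⟩
  have hpos : 0 < ‖1 - z‖ := norm_pos_iff.2 (sub_ne_zero.2 hz1.symm)
  have hle2 : ‖1 - z‖ ≤ 2 := (norm_sub_le _ _).trans (by rw [hz]; norm_num)
  have hpα : 0 ≤ ‖1 - z‖ ^ (-α) := by positivity
  have hzarg : Complex.exp (Complex.I * (z.arg : ℂ)) = z := by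
    have := Complex.norm_mul_exp_arg_mul_I z
    rw [hz] at this
    simpa [mul_comm] using this
  by_cases hd : δ ≤ |z.arg|
  · calc ‖resolvent T z‖ ≤ |C₂| := (hC₂ z ⟨by simpa using hz, hd⟩).trans (le_abs_self _)
      _ = |C₂| / 2 ^ (-α) * 2 ^ (-α) := by field_simp
      _ ≤ |C₂| / 2 ^ (-α) * ‖1 - z‖ ^ (-α) := by
          refine mul_le_mul_of_nonneg_left ?_ (by positivity)
          exact Real.rpow_le_rpow_of_nonpos hpos hle2 (by linarith)
      _ ≤ _ := by nlinarith
  · have harg : z.arg ≠ 0 := by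
      intro h0
      rw [h0] at hzarg
      exact hz1 (by simpa using hzarg.symm)
    have h := hb (y := z.arg) (by simpa using hd) harg
    rw [hzarg] at h
    have hchord : ‖1 - z‖ ≤ |z.arg| := by
      have := Real.norm_exp_I_mul_ofReal_sub_one_le (x := z.arg)
      rwa [hzarg, norm_sub_rev, Real.norm_eq_abs] at this
    calc ‖resolvent T z‖ ≤ C₁ * |z.arg| ^ (-α) := by
          simpa [abs_of_nonneg (Real.rpow_nonneg (abs_nonneg z.arg) (-α))] using h
      _ ≤ C₁ * ‖1 - z‖ ^ (-α) :=
          mul_le_mul_of_nonneg_left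
            (Real.rpow_le_rpow_of_nonpos hpos hchord (by linarith)) hC₁.le
      _ ≤ _ := by
          have : 0 ≤ |C₂| / 2 ^ (-α) := by positivity
          nlinarith

/-! ### Cesàro means -/

/-- The Cesàro mean `(1 + T + ⋯ + T ^ (m - 1)) / m`. -/
noncomputable def cesaroMean {X : Type*} [NormedAddCommGroup X] [NormedSpace ℂ X]
    (T : X →L[ℂ] X) (m : ℕ) : X →L[ℂ] X :=
  (m : ℂ)⁻¹ • ∑ j ∈ Finset.range m, T ^ j

/-- The quotient of `1 - cesaroMean T m` by `1 - T`, as a polynomial in `T`. -/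
noncomputable def cesaroQuotient {X : Type*} [NormedAddCommGroup X] [NormedSpace ℂ X]
    (T : X →L[ℂ] X) (m : ℕ) : X →L[ℂ] X :=
  (m : ℂ)⁻¹ • ∑ j ∈ Finset.range m, ∑ i ∈ Finset.range j, T ^ i

section Cesaro

variable {X : Type*} [NormedAddCommGroup X] [NormedSpace ℂ X] {T : X →L[ℂ] X} {M : ℝ} {m : ℕ}

lemma commute_cesaroMean (T : X →L[ℂ] X) (m : ℕ) : Commute T (cesaroMean T m) :=
  (Commute.sum_right _ _ _ fun j _ => (Commute.refl T).pow_right j).smul_right _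

lemma norm_sum_pow_le (hM : ∀ n : ℕ, ‖T ^ n‖ ≤ M) (j : ℕ) :
    ‖∑ i ∈ Finset.range j, T ^ i‖ ≤ j * M := by
  simpa using norm_sum_le_of_le (Finset.range j) fun i _ => hM i

lemma norm_cesaroMean_le (hM : ∀ n : ℕ, ‖T ^ n‖ ≤ M) (hm : 0 < m) :
    ‖cesaroMean T m‖ ≤ M := by
  have hm' : (0 : ℝ) < m := by exact_mod_cast hm
  rw [cesaroMean, norm_smul, norm_inv, Complex.norm_natCast, inv_mul_le_iff₀ hm']
  exact norm_sum_pow_le hM m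

lemma norm_cesaroQuotient_le (hM : ∀ n : ℕ, ‖T ^ n‖ ≤ M) (hm : 0 < m) :
    ‖cesaroQuotient T m‖ ≤ M * m := by
  have hm' : (0 : ℝ) < m := by exact_mod_cast hm
  have hM0 : 0 ≤ M := (norm_nonneg _).trans (hM 0)
  rw [cesaroQuotient, norm_smul, norm_inv, Complex.norm_natCast, inv_mul_le_iff₀ hm']
  have h : ∀ j ∈ Finset.range m, ‖∑ i ∈ Finset.range j, T ^ i‖ ≤ m * M := fun j hj =>
    (norm_sum_pow_le hM j).trans (mul_le_mul_of_nonneg_right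
      (by exact_mod_cast (Finset.mem_range.1 hj).le) hM0)
  refine (norm_sum_le_of_le _ h).trans (le_of_eq ?_)
  rw [Finset.sum_const, Finset.card_range, nsmul_eq_mul, mul_comm (m : ℝ) M]

lemma one_sub_mul_cesaroMean :
    (1 - T) * cesaroMean T m = (m : ℂ)⁻¹ • (1 - T ^ m) := by
  rw [cesaroMean, mul_smul_comm, mul_neg_geom_sum]

lemma one_sub_mul_cesaroQuotient (hm : 0 < m) :
    (1 - T) * cesaroQuotient T m = 1 - cesaroMean T m := by
  have hm' : (m : ℂ) ≠ 0 := by exact_mod_cast hm.ne'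
  rw [cesaroQuotient, mul_smul_comm, Finset.mul_sum]
  simp only [mul_neg_geom_sum]
  rw [Finset.sum_sub_distrib, smul_sub, cesaroMean]
  congr 1
  rw [Finset.sum_const, Finset.card_range, ← Nat.cast_smul_eq_nsmul ℂ, smul_smul,
    inv_mul_cancel₀ hm', one_smul]

lemma norm_one_sub_cesaroMean_pow_le (hM : ∀ n : ℕ, ‖T ^ n‖ ≤ M) (hm : 0 < m) (p : ℕ) :
    ‖(1 - cesaroMean T m) ^ p‖ ≤ (1 + M) ^ p := by
  have h1 : ‖(1 : X →L[ℂ] X)‖ ≤ 1 := ContinuousLinearMap.norm_id_le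
  have h2 : ‖1 - cesaroMean T m‖ ≤ 1 + M :=
    (norm_sub_le _ _).trans (add_le_add h1 (norm_cesaroMean_le hM hm))
  induction p with
  | zero => simpa using h1
  | succ p ih =>
    rw [pow_succ, pow_succ]
    exact (norm_mul_le _ _).trans (mul_le_mul ih h2 (norm_nonneg _) ((norm_nonneg _).trans ih))

/-- Replacing `1 - T` by `(1 - T) (1 - A) ^ p`, with `A` the Cesàro mean of length `m`, costs
`O(1 / m)`. -/
lemma norm_one_sub_sub_mul_pow_le (hM : ∀ n : ℕ, ‖T ^ n‖ ≤ M) (hm : 0 < m) (p : ℕ) :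
    ‖(1 - T) - (1 - T) * (1 - cesaroMean T m) ^ p‖ ≤ p * (1 + M) ^ (p + 1) / m := by
  have hm' : (0 : ℝ) < m := by exact_mod_cast hm
  have hM0 : 0 ≤ M := (norm_nonneg _).trans (hM 0)
  have h1 : ‖(1 : X →L[ℂ] X)‖ ≤ 1 := ContinuousLinearMap.norm_id_le
  have hstep : ‖(1 - T) * cesaroMean T m‖ ≤ (1 + M) / m := by
    rw [one_sub_mul_cesaroMean, norm_smul, norm_inv, Complex.norm_natCast, inv_mul_eq_div]
    gcongr
    exact (norm_sub_le _ _).trans (add_le_add h1 (hM m))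
  have hid : (1 - T) - (1 - T) * (1 - cesaroMean T m) ^ p
      = (1 - T) * cesaroMean T m * ∑ i ∈ Finset.range p, (1 - cesaroMean T m) ^ i := by
    have := mul_neg_geom_sum (1 - cesaroMean T m) p
    rw [sub_sub_cancel] at this
    rw [mul_assoc, this, mul_sub, mul_one]
  have hsum : ‖∑ i ∈ Finset.range p, (1 - cesaroMean T m) ^ i‖ ≤ p * (1 + M) ^ p := by
    have : ∀ i ∈ Finset.range p, ‖(1 - cesaroMean T m) ^ i‖ ≤ (1 + M) ^ p := fun i hi =>
      (norm_one_sub_cesaroMean_pow_le hM hm i).trans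
        (pow_le_pow_right₀ (by linarith) (Finset.mem_range.1 hi).le)
    simpa using norm_sum_le_of_le _ this
  rw [hid]
  calc _ ≤ (1 + M) / m * (p * (1 + M) ^ p) :=
        (norm_mul_le _ _).trans (mul_le_mul hstep hsum (norm_nonneg _) (by positivity))
    _ = _ := by ring

/-- If `W Q = E + W E`, as happens for `W = (1 - z) R(z, T)`, `Q = (1 - T) B` and `E = (1 - z) B`,
then each factor `Q` may be traded for a factor `E`, at the cost of a bounded term. -/
lemma norm_mul_pow_le_of_mul_eq {R : Type*} [NormedRing R] {W Q E : R}
    (hW : W * Q = E + W * E) (hQE : Commute Q E) {M : ℝ} (hM : 0 ≤ M)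
    (hQ : ∀ p : ℕ, ‖Q ^ p‖ ≤ (1 + M) ^ p) (hE : ‖E‖ ≤ M) (p : ℕ) :
    ‖W * Q ^ p‖ ≤ p * (1 + M) ^ p + ‖W‖ * ‖E‖ ^ p := by
  induction p with
  | zero => simp
  | succ p ih =>
    have hid : W * Q ^ (p + 1) = E * Q ^ p + W * Q ^ p * E := by
      rw [pow_succ', ← mul_assoc, hW, add_mul, mul_assoc, mul_assoc, (hQE.pow_left p).eq]
    have hpow : 0 ≤ (1 + M) ^ p := by positivity
    have hp : (0 : ℝ) ≤ p := p.cast_nonneg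
    calc ‖W * Q ^ (p + 1)‖ ≤ ‖E‖ * ‖Q ^ p‖ + ‖W * Q ^ p‖ * ‖E‖ := by
          rw [hid]
          exact (norm_add_le _ _).trans (add_le_add (norm_mul_le _ _) (norm_mul_le _ _))
      _ ≤ M * (1 + M) ^ p + (p * (1 + M) ^ p + ‖W‖ * ‖E‖ ^ p) * ‖E‖ :=
          add_le_add (mul_le_mul hE (hQ p) (norm_nonneg _) hM)
            (mul_le_mul_of_nonneg_right ih (norm_nonneg _))
      _ = M * (1 + M) ^ p + p * (1 + M) ^ p * ‖E‖ + ‖W‖ * ‖E‖ ^ (p + 1) := by ring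
      _ ≤ (1 + M) * (1 + M) ^ p + p * (1 + M) ^ p * (1 + M) + ‖W‖ * ‖E‖ ^ (p + 1) := by
          gcongr <;> linarith
      _ = _ := by push_cast; ring

/-- Regularising with `p ≥ α` factors `1 - A`, where `A` is the Cesàro mean of length `m`, lowers
the growth of the resolvent to `O(m ^ (α - 1))`, uniformly on the punctured circle. -/
lemma exists_resolvent_mul_cesaro_bound (hM : ∀ n : ℕ, ‖T ^ n‖ ≤ M) {α C : ℝ} (hα : 1 ≤ α)
    (hC : 0 ≤ C) (hu : ∀ z : ℂ, ‖z‖ = 1 → z ≠ 1 → z ∈ resolventSet ℂ T)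
    (hR : ∀ z : ℂ, ‖z‖ = 1 → z ≠ 1 → ‖resolvent T z‖ ≤ C * ‖1 - z‖ ^ (-α))
    {p : ℕ} (hp : α ≤ p) :
    ∃ K : ℝ, 0 ≤ K ∧ ∀ m : ℕ, 0 < m → ∀ z : ℂ, ‖z‖ = 1 → z ≠ 1 →
      ‖resolvent T z * ((1 - T) * (1 - cesaroMean T m) ^ p)‖ ≤ K * (m : ℝ) ^ (α - 1) := by
  have hM0 : 0 ≤ M := (norm_nonneg _).trans (hM 0)
  have hpow : 0 ≤ (1 + M) ^ p := by positivity
  have hMp : M ^ p ≤ (1 + M) ^ p := pow_le_pow_left₀ hM0 (by linarith) p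
  have hp0 : (0 : ℝ) ≤ p := p.cast_nonneg
  refine ⟨(1 + p + C) * (1 + M) ^ p, by positivity, fun m hm z hz hz1 => ?_⟩
  have hm' : (0 : ℝ) < m := by exact_mod_cast hm
  have hm1 : (1 : ℝ) ≤ m := by exact_mod_cast hm
  have hmα : 1 ≤ (m : ℝ) ^ (α - 1) := Real.one_le_rpow hm1 (by linarith)
  set R := resolvent T z with hRdef
  set Q := 1 - cesaroMean T m with hQ
  set B := cesaroQuotient T m with hB
  set W := (1 - z) • R with hW
  have hδ : 0 < ‖1 - z‖ := norm_pos_iff.2 (sub_ne_zero.2 hz1.symm)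
  have hWn : ‖W‖ ≤ C * ‖1 - z‖ ^ (1 - α) := by
    rw [hW, norm_smul, sub_eq_add_neg 1 α, Real.rpow_add hδ, Real.rpow_one, mul_left_comm]
    exact mul_le_mul_of_nonneg_left (hR z hz hz1) hδ.le
  have hRT : R * (1 - T) = 1 + W := by
    have hinv : R * (algebraMap ℂ (X →L[ℂ] X) z - T) = 1 :=
      Ring.inverse_mul_cancel _ (hu z hz hz1)
    have : (1 : X →L[ℂ] X) - T
        = (algebraMap ℂ (X →L[ℂ] X) z - T) + algebraMap ℂ (X →L[ℂ] X) (1 - z) := by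
      rw [map_sub, map_one]; abel
    rw [this, mul_add, hinv, hW, ← Algebra.commutes, ← Algebra.smul_def]
  have hQn := norm_one_sub_cesaroMean_pow_le hM hm
  -- it suffices to bound `W * Q ^ p`
  suffices h : ‖W * Q ^ p‖ ≤ (p + C) * (1 + M) ^ p * (m : ℝ) ^ (α - 1) by
    rw [← mul_assoc, hRT, add_mul, one_mul]
    have h1 : (1 + M) ^ p * 1 ≤ (1 + M) ^ p * (m : ℝ) ^ (α - 1) :=
      mul_le_mul_of_nonneg_left hmα hpow
    have h2 := norm_add_le (Q ^ p) (W * Q ^ p)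
    have h3 := hQn p
    rw [← hQ] at h3
    linarith
  by_cases hcase : 1 ≤ ‖1 - z‖ * m
  · have h1 : ‖1 - z‖ ^ (1 - α) ≤ (m : ℝ) ^ (α - 1) := by
      have hinv : (m : ℝ)⁻¹ ≤ ‖1 - z‖ := by rwa [inv_le_iff_one_le_mul₀ hm']
      calc ‖1 - z‖ ^ (1 - α) ≤ (m : ℝ)⁻¹ ^ (1 - α) :=
            Real.rpow_le_rpow_of_nonpos (by positivity) hinv (by linarith)
        _ = (m : ℝ) ^ (α - 1) := by
            rw [Real.inv_rpow hm'.le, ← Real.rpow_neg hm'.le, neg_sub]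
    calc ‖W * Q ^ p‖ ≤ (C * ‖1 - z‖ ^ (1 - α)) * (1 + M) ^ p :=
          (norm_mul_le _ _).trans (mul_le_mul hWn (hQn p) (norm_nonneg _) (by positivity))
      _ ≤ (C * (m : ℝ) ^ (α - 1)) * (1 + M) ^ p := by gcongr
      _ ≤ _ := by nlinarith [mul_nonneg (mul_nonneg hp0 hpow) (zero_le_one.trans hmα)]
  · have hcase' : ‖1 - z‖ * m ≤ 1 := (not_le.1 hcase).le
    set E := (1 - z) • B with hE
    have hQB : Q = (1 - T) * B := (one_sub_mul_cesaroQuotient hm).symm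
    have hWQ : W * Q = E + W * E := by
      calc W * Q = (1 - z) • ((R * (1 - T)) * B) := by
            rw [hQB, hW, smul_mul_assoc, mul_assoc]
        _ = E + W * E := by
            rw [hRT, add_mul, one_mul, smul_add, hE, mul_smul_comm]
    have hTB : Commute T B :=
      (Commute.sum_right _ _ _ fun j _ => Commute.sum_right _ _ _ fun i _ =>
        (Commute.refl T).pow_right i).smul_right _
    have hQE : Commute Q E := by
      refine Commute.smul_right ?_ _
      rw [hQB]
      exact ((Commute.one_left B).sub_left hTB).mul_left (Commute.refl B)
    have hEn : ‖E‖ ≤ M * (‖1 - z‖ * m) := by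
      rw [hE, norm_smul, mul_left_comm]
      exact mul_le_mul_of_nonneg_left (norm_cesaroQuotient_le hM hm) hδ.le
    have hEM : ‖E‖ ≤ M := hEn.trans (mul_le_of_le_one_right hM0 hcase')
    have hmain := norm_mul_pow_le_of_mul_eq hWQ hQE hM0 hQn hEM p
    have hWE : ‖W‖ * ‖E‖ ^ p ≤ C * (1 + M) ^ p * (m : ℝ) ^ (α - 1) := by
      -- `p ≥ α - 1` is what makes `(‖1 - z‖ m) ^ p` absorb `(‖1 - z‖ m) ^ (1 - α)`
      have hs : ‖1 - z‖ ^ (1 - α) * (‖1 - z‖ * m) ^ p ≤ (m : ℝ) ^ (α - 1) := by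
        set s := ‖1 - z‖ * m with hs
        have hs0 : 0 < s := by positivity
        have e : ‖1 - z‖ ^ (1 - α) = s ^ (1 - α) * (m : ℝ) ^ (α - 1) := by
          rw [hs, Real.mul_rpow hδ.le hm'.le, mul_assoc, ← Real.rpow_add hm']
          simp
        have h1 : s ^ (1 - α) * s ^ p ≤ 1 := by
          rw [← Real.rpow_natCast, ← Real.rpow_add hs0]
          exact Real.rpow_le_one hs0.le hcase' (by linarith)
        calc _ = (s ^ (1 - α) * s ^ p) * (m : ℝ) ^ (α - 1) := by rw [e]; ring
          _ ≤ 1 * (m : ℝ) ^ (α - 1) := by gcongr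
          _ = _ := one_mul _
      calc ‖W‖ * ‖E‖ ^ p
          ≤ (C * ‖1 - z‖ ^ (1 - α)) * (M * (‖1 - z‖ * m)) ^ p := by gcongr
        _ = C * M ^ p * (‖1 - z‖ ^ (1 - α) * (‖1 - z‖ * m) ^ p) := by ring
        _ ≤ C * (1 + M) ^ p * (m : ℝ) ^ (α - 1) := by gcongr
    have h1 : (p : ℝ) * (1 + M) ^ p * 1 ≤ p * (1 + M) ^ p * (m : ℝ) ^ (α - 1) :=
      mul_le_mul_of_nonneg_left hmα (by positivity)
    linarith

end Cesaro

/-! ### The decay rate -/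

theorem theorem3p3 {X : Type*} [NormedAddCommGroup X] [InnerProductSpace ℂ X]
    [CompleteSpace X] (T : X →L[ℂ] X) (hT : IsPowerBoundedOperator T)
    (hσ : unitarySpectrum T ⊆ {1}) (α : ℝ) (hα : 1 ≤ α)
    (hres : (fun θ : ℝ => ‖resolvent T (Complex.exp (Complex.I * (θ : ℂ)))‖)
      =O[𝓝[≠] (0 : ℝ)] fun θ : ℝ => |θ| ^ (-α)) :
    (fun n : ℕ => ‖T ^ n * (1 - T)‖) =O[atTop] fun n : ℕ => (n : ℝ) ^ (-(1 / α)) := by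
  obtain ⟨M, hM⟩ := hT
  have hM0 : 0 ≤ M := (norm_nonneg _).trans (hM 0)
  have hα0 : 0 < α := by linarith
  have hu : ∀ z : ℂ, ‖z‖ = 1 → z ≠ 1 → z ∈ resolventSet ℂ T := fun z hz hz1 =>
    mem_resolventSet_of_unitarySpectrum_subset hσ hz hz1
  obtain ⟨C, hC, hR⟩ := exists_resolvent_bound_circle hσ hα0.le hres
  obtain ⟨p, hp⟩ := exists_nat_ge α
  obtain ⟨K, hK, hKb⟩ := exists_resolvent_mul_cesaro_bound hM hα hC hu hR hp
  refine IsBigO.of_bound (3 * M ^ 2 * (K * 2 ^ (α - 1)) + M * (p * (1 + M) ^ (p + 1))) ?_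
  filter_upwards [eventually_gt_atTop 0] with n hn
  have hn' : (0 : ℝ) < n := by exact_mod_cast hn
  have hn1 : (1 : ℝ) ≤ n := by exact_mod_cast hn
  set s : ℝ := (n : ℝ) ^ (1 / α) with hs
  have hs1 : 1 ≤ s := Real.one_le_rpow hn1 (by positivity)
  have hs0 : 0 < s := by linarith
  set m : ℕ := ⌈s⌉₊ with hmdef
  have hm : 0 < m := Nat.ceil_pos.2 hs0
  have hm' : (0 : ℝ) < m := by exact_mod_cast hm
  have hsm : s ≤ m := Nat.le_ceil s
  have hms : (m : ℝ) ≤ 2 * s := by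
    have := Nat.ceil_lt_add_one hs0.le
    linarith
  have hsα : s ^ (α - 1) / n = s⁻¹ := by
    have : s ^ α = n := by
      rw [hs, ← Real.rpow_mul hn'.le, one_div, inv_mul_cancel₀ hα0.ne', Real.rpow_one]
    rw [Real.rpow_sub hs0, this, Real.rpow_one]
    field_simp
  have hrhs : (n : ℝ) ^ (-(1 / α)) = s⁻¹ := Real.rpow_neg hn'.le _
  set S := (1 - T) * (1 - cesaroMean T m) ^ p with hS
  have hTS : Commute T S := by
    refine Commute.mul_right ?_ (Commute.pow_right ?_ p)
    · exact (Commute.one_right T).sub_right (Commute.refl T)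
    · exact (Commute.one_right T).sub_right (commute_cesaroMean T m)
  have hmα : (m : ℝ) ^ (α - 1) ≤ 2 ^ (α - 1) * s ^ (α - 1) := by
    rw [← Real.mul_rpow (by norm_num) hs0.le]
    exact Real.rpow_le_rpow hm'.le hms (by linarith)
  have hmain : ‖T ^ n * S‖ ≤ 3 * M ^ 2 * (K * 2 ^ (α - 1)) * s⁻¹ := by
    calc ‖T ^ n * S‖ ≤ 3 * M ^ 2 * (K * (m : ℝ) ^ (α - 1)) / n :=
          norm_pow_mul_le_of_resolvent_mul_bound hTS hM (by positivity) hu (hKb m hm) hn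
      _ ≤ 3 * M ^ 2 * (K * (2 ^ (α - 1) * s ^ (α - 1))) / n := by gcongr
      _ = 3 * M ^ 2 * (K * 2 ^ (α - 1)) * (s ^ (α - 1) / n) := by ring
      _ = _ := by rw [hsα]
  have hrem : ‖T ^ n * ((1 - T) - S)‖ ≤ M * (p * (1 + M) ^ (p + 1)) * s⁻¹ := by
    calc ‖T ^ n * ((1 - T) - S)‖ ≤ M * (p * (1 + M) ^ (p + 1) / m) :=
          (norm_mul_le _ _).trans (mul_le_mul (hM n) (norm_one_sub_sub_mul_pow_le hM hm p)
            (norm_nonneg _) hM0)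
      _ ≤ M * (p * (1 + M) ^ (p + 1) / s) := by gcongr
      _ = _ := by ring
  rw [norm_norm, hrhs, Real.norm_of_nonneg (inv_nonneg.2 hs0.le)]
  calc ‖T ^ n * (1 - T)‖ = ‖T ^ n * S + T ^ n * ((1 - T) - S)‖ := by
        rw [← mul_add, add_sub_cancel]
    _ ≤ _ := (norm_add_le _ _).trans (by rw [add_mul]; exact add_le_add hmain hrem)
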